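/- **Setting.** Let $(\breve N,\breve g)$ be a semi-Riemannian manifold (a smooth manifold with a smooth symmetric nondegenerate $(0,2)$-tensor field of constant index) with Levi-Civita connection $\breve\nabla$. Let $p,q$ be positive integers and let $\breve J$ be a smooth $(1,1)$-tensor field on $\breve N$ with $$\breve J^2=p\,\breve J+q\,I,\qquad \breve g(\breve JX,Y)=\breve g(X,\breve JY),\qquad \breve\nabla_X(\breve JY)=\breve J\,\breve\nabla_XY ,$$ so that $(\breve N,\breve g,\breve J)$ is a locally metallic semi-Riemannian manifold. Let $\acute N$ be a lightlike submanifold of $\breve N$: an immersed $m$-dimensional submanifold whose radical distribution $Rad(T\acute N)=T\acute N\cap T\acute N^{\perp}$ has constant rank $r$ with $1\le r\le m$. Fix a screen distribution $S(T\acute N)$ (a smooth complement of $Rad(T\acute N)$ in $T\acute N$), a screen transversal bundle $S(T\acute N^{\perp})$ (a smooth complement of $Rad(T\acute N)$ in $T\acute N^{\perp}$), and a lightlike transversal bundle $ltr(T\acute N)$, that is, a smooth totally isotropic subbundle of $T\breve N|_{\acute N}$, orthogonal to $S(T\acute N)$ and to $S(T\acute N^{\perp})$, such that $tr(T\acute N)=ltr(T\acute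 N)\oplus S(T\acute N^{\perp})$ is a complement of $T\acute N$ in $T\breve N|_{\acute N}$. Assume that $\acute N$ is radical screen transversal: $$\breve J\,Rad(T\acute N)\subset S(T\acute N^{\perp}),\qquad \breve J\,S(T\acute N)=S(T\acute N).$$ For vector fields $W,U$ on $\acute N$ and a section $V$ of $tr(T\acute N)$, let $\nabla_WU$ and $-A_VW$ be the components in $T\acute N$ of $\breve\nabla_WU$ and $\breve\nabla_WV$, with respect to $T\breve N|_{\acute N}=T\acute N\oplus tr(T\acute N)$. For $\xi\in\Gamma(Rad(T\acute N))$ let $-A^*_\xi W$ be the component in $S(T\acute N)$ of $\nabla_W\xi$, with respect to $T\acute N=S(T\acute N)\oplus Rad(T\acute N)$. The distribution $Rad(T\acute N)$ is called integrable if $[W,U]\in\Gamma(Rad(T\acute N))$ for all $W,U\in\Gamma(Rad(T\acute N))$. **Theorem.** For $W,U\in\Gamma(Rad(T\acute N))$ consider the conditions 1. $A_{\breve JW}U-A_{\breve JU}W=p\,\bigl(A^*_WU-A^*_UW\bigr)$; 2. $A^*_WU=A^*_UW$ and $A_{\breve JW}U-A_{\breve JU}W\in\Gamma(Rad(T\acute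 N))$. Then $Rad(T\acute N)$ is integrable if and only if either (1) holds for all $W,U\in\Gamma(Rad(T\acute N))$ or (2) holds for all $W,U\in\Gamma(Rad(T\acute N))$. It is also integrable if and only if, for all $W,U\in\Gamma(Rad(T\acute N))$, at least one of (1) and (2) holds. -/

import Mathlib

open scoped Manifold ContDiff Bundle

set_option linter.unusedSectionVars false

noncomputable section

namespace Lightlike

/-! Manifolds are smooth, without boundary, and modelled on a finite-dimensional real normed
space: `E` for the ambient manifold `A`, and `F` for the submanifold `N`. -/

/-! ### Semi-Riemannian metrics and the Levi-Civita connection -/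

section Metric

/-- A semi-Riemannian metric on a manifold `A`: a smooth field of symmetric
nondegenerate bilinear forms on the tangent spaces, of constant index. -/
structure SemiRiemannianMetric (E : Type*) [NormedAddCommGroup E] [NormedSpace ℝ E]
    (A : Type*) [TopologicalSpace A] [ChartedSpace E A] [IsManifold 𝓘(ℝ, E) ∞ A] where
  /-- The bilinear form on each tangent space. -/
  form (z : A) : TangentSpace 𝓘(ℝ, E) z →L[ℝ] TangentSpace 𝓘(ℝ, E) z →L[ℝ] ℝ
  symm (z : A) (v w : TangentSpace 𝓘(ℝ, E) z) : form z v w = form z w v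
  nondegenerate (z : A) (v : TangentSpace 𝓘(ℝ, E) z) (hv : ∀ w, form z v w = 0) : v = 0
  contMDiff : ContMDiff 𝓘(ℝ, E) (𝓘(ℝ, E).prod 𝓘(ℝ, E →L[ℝ] E →L[ℝ] ℝ)) ∞
    (fun z : A ↦ Bundle.TotalSpace.mk' (E →L[ℝ] E →L[ℝ] ℝ)
      (E := fun z : A ↦ TangentSpace 𝓘(ℝ, E) z →L[ℝ] TangentSpace 𝓘(ℝ, E) z →L[ℝ] ℝ) z (form z))
  /-- The index: the maximal dimension of a negative definite subspace. -/
  index : ℕ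
  index_eq (z : A) : IsGreatest {d : ℕ | ∃ L : Submodule ℝ (TangentSpace 𝓘(ℝ, E) z),
    Module.finrank ℝ L = d ∧ ∀ v ∈ L, v ≠ 0 → form z v v < 0} index

variable {E : Type*} [NormedAddCommGroup E] [NormedSpace ℝ E] [FiniteDimensional ℝ E]
  {A : Type*} [TopologicalSpace A] [ChartedSpace E A]
  [IsManifold 𝓘(ℝ, E) ∞ A]

/-- The components at `y` of the tangent vector `v` at `y`, in the preferred chart around `z`. -/
def toCoord (z y : A) : TangentSpace 𝓘(ℝ, E) y →L[ℝ] E :=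
  (trivializationAt E (TangentSpace 𝓘(ℝ, E)) z).continuousLinearMapAt ℝ y

/-- The tangent vector at `y` with the given components in the preferred chart around `z`. -/
def ofCoord (z y : A) : E →L[ℝ] TangentSpace 𝓘(ℝ, E) y :=
  (trivializationAt E (TangentSpace 𝓘(ℝ, E)) z).symmL ℝ y

instance (z : A) : FiniteDimensional ℝ (TangentSpace 𝓘(ℝ, E) z) :=
  inferInstanceAs (FiniteDimensional ℝ E)

namespace SemiRiemannianMetric

variable (g : SemiRiemannianMetric E A)

/-- The metric at `z` as a bilinear form. -/
def bilin (z : A) : LinearMap.BilinForm ℝ (TangentSpace 𝓘(ℝ, E) z) :=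
  LinearMap.mk₂ ℝ (fun v w ↦ g.form z v w) (by simp) (by simp) (by simp) (by simp)

@[simp] lemma bilin_apply (z : A) (v w : TangentSpace 𝓘(ℝ, E) z) :
    g.bilin z v w = g.form z v w := rfl

lemma bilin_nondegenerate (z : A) : (g.bilin z).Nondegenerate :=
  ⟨fun v hv ↦ g.nondegenerate z v hv, fun v hv ↦ g.nondegenerate z v fun w ↦ by
    rw [g.symm]; exact hv w⟩

/-- The coefficients `g_{ij}` of the metric near `z`, in the preferred chart around `z`. -/
def coordForm (z y : A) : E →L[ℝ] E →L[ℝ] ℝ :=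
  ((ofCoord z y).precomp ℝ) ∘L (g.form y) ∘L (ofCoord z y)

lemma coordForm_apply (z y : A) (b d : E) :
    g.coordForm z y b d = g.form y (ofCoord z y b) (ofCoord z y d) := rfl

/-- The derivative at `z` of the metric coefficients in the preferred chart around `z`:
`dCoordForm z a b d` is `∂_a g(b, d)`. -/
def dCoordForm (z : A) : TangentSpace 𝓘(ℝ, E) z →L[ℝ] E →L[ℝ] E →L[ℝ] ℝ :=
  mvfderiv 𝓘(ℝ, E) (g.coordForm z) z

/-- The covector `d ↦ ½ (∂_a g(b, d) + ∂_b g(a, d) - ∂_d g(a, b))` at `z`, the Christoffel symbols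
of the first kind in the preferred chart around `z`. -/
def christoffelFirst (z : A) (a b : TangentSpace 𝓘(ℝ, E) z) :
    Module.Dual ℝ (TangentSpace 𝓘(ℝ, E) z) where
  toFun d := (1 / 2 : ℝ) * (g.dCoordForm z a (toCoord z z b) (toCoord z z d)
    + g.dCoordForm z b (toCoord z z a) (toCoord z z d)
    - g.dCoordForm z d (toCoord z z a) (toCoord z z b))
  map_add' d d' := by
    rw [(toCoord z z).map_add, (g.dCoordForm z).map_add, map_add, map_add, add_apply, add_apply]
    ring
  map_smul' c d := by
    rw [(toCoord z z).map_smul, (g.dCoordForm z).map_smul, map_smul, map_smul, smul_apply,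
      smul_apply]
    simp only [smul_eq_mul, RingHom.id_apply]
    ring

/-- The vector `Γ(a, b)` at `z` given by the Christoffel symbols of the second kind in the
preferred chart around `z`: the vector with `g(Γ(a, b), d) = christoffelFirst a b d`. -/
def christoffel (z : A) (a b : TangentSpace 𝓘(ℝ, E) z) : TangentSpace 𝓘(ℝ, E) z :=
  ((g.bilin z).toDual (g.bilin_nondegenerate z)).symm (g.christoffelFirst z a b)

end SemiRiemannianMetric

end Metric

/-! ### Vector fields along a map and their covariant derivative -/

section Along

variable {E : Type*} [NormedAddCommGroup E] [NormedSpace ℝ E] [FiniteDimensional ℝ E]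
  {A : Type*} [TopologicalSpace A] [ChartedSpace E A]
  [IsManifold 𝓘(ℝ, E) ∞ A]
  {F : Type*} [NormedAddCommGroup F] [NormedSpace ℝ F] 
  {N : Type*} [TopologicalSpace N] [ChartedSpace F N]

/-- A vector field `V` along `f : N → A`, that is a section of `f^* TA`, is smooth. -/
def IsSmoothAlongAt (f : N → A) (V : ∀ x, TangentSpace 𝓘(ℝ, E) (f x)) (x : N) : Prop :=
  ContMDiffAt 𝓘(ℝ, F) 𝓘(ℝ, E).tangent ∞ (fun y ↦ (⟨f y, V y⟩ : TangentBundle 𝓘(ℝ, E) A)) x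

/-- A family of subspaces of the fibres of `f^* TA` is a smooth vector subbundle: near every point
it has a frame made of smooth sections. -/
def IsSmoothSubbundleAlong (f : N → A) (D : ∀ x, Submodule ℝ (TangentSpace 𝓘(ℝ, E) (f x))) : Prop :=
  ∀ x : N, ∃ (d : ℕ) (X : Fin d → ∀ y, TangentSpace 𝓘(ℝ, E) (f y)),
    (∀ i, IsSmoothAlongAt (F := F) f (X i) x) ∧
    ∀ᶠ y in nhds x, LinearIndependent ℝ (fun i ↦ X i y) ∧
      D y = Submodule.span ℝ (Set.range fun i ↦ X i y)

/-- The Levi-Civita covariant derivative along `f : N → A`: the derivative at `x`, in the direction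
`w ∈ T_x N`, of the vector field `V` along `f`. In the preferred chart of `A` around `f x` it is
`∂_w V^k + Γ^k_{ij} (df w)^i V^j`. -/
def covDerivAlong (g : SemiRiemannianMetric E A) (f : N → A)
    (V : ∀ x, TangentSpace 𝓘(ℝ, E) (f x)) (x : N) (w : TangentSpace 𝓘(ℝ, F) x) :
    TangentSpace 𝓘(ℝ, E) (f x) :=
  ofCoord (f x) (f x) (mvfderiv 𝓘(ℝ, F) (fun y ↦ toCoord (f x) (f y) (V y)) x w)
    + g.christoffel (f x) (mfderiv 𝓘(ℝ, F) 𝓘(ℝ, E) f x w) (V x)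

/-- A vector field on `A` is smooth. -/
abbrev IsSmoothField (V : ∀ z : A, TangentSpace 𝓘(ℝ, E) z) : Prop :=
  ContMDiff 𝓘(ℝ, E) 𝓘(ℝ, E).tangent ∞ (fun z ↦ (⟨z, V z⟩ : TangentBundle 𝓘(ℝ, E) A))

/-- The Levi-Civita connection of `g`: the derivative `∇_a V` at `z` of a vector field `V`. -/
def leviCivita (g : SemiRiemannianMetric E A) (V : ∀ z : A, TangentSpace 𝓘(ℝ, E) z) (z : A)
    (a : TangentSpace 𝓘(ℝ, E) z) : TangentSpace 𝓘(ℝ, E) z :=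
  covDerivAlong (F := E) g (fun y : A ↦ y) V z a

end Along

/-! ### Metallic structures -/

/-- A metallic structure compatible with the semi-Riemannian metric `g`: positive integers `p`, `q`
and a smooth `(1,1)`-tensor field `J` with `J² = p J + q I` and `g(J v, w) = g(v, J w)`. Together
with `g` it makes `A` a metallic semi-Riemannian manifold. -/
structure MetallicStructure {E : Type*} [NormedAddCommGroup E] [NormedSpace ℝ E]
    [FiniteDimensional ℝ E] {A : Type*} [TopologicalSpace A] [ChartedSpace E A]
    [IsManifold 𝓘(ℝ, E) ∞ A] (g : SemiRiemannianMetric E A) (p q : ℕ) where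
  p_pos : 0 < p
  q_pos : 0 < q
  /-- The tensor field `J`. -/
  J (z : A) : TangentSpace 𝓘(ℝ, E) z →L[ℝ] TangentSpace 𝓘(ℝ, E) z
  contMDiff : ContMDiff 𝓘(ℝ, E) (𝓘(ℝ, E).prod 𝓘(ℝ, E →L[ℝ] E)) ∞
    (fun z : A ↦ Bundle.TotalSpace.mk' (E →L[ℝ] E)
      (E := fun z : A ↦ TangentSpace 𝓘(ℝ, E) z →L[ℝ] TangentSpace 𝓘(ℝ, E) z) z (J z))
  metallic (z : A) (v : TangentSpace 𝓘(ℝ, E) z) : J z (J z v) = (p : ℝ) • J z v + (q : ℝ) • v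
  compatible (z : A) (v w : TangentSpace 𝓘(ℝ, E) z) : g.form z (J z v) w = g.form z v (J z w)

/-- The metallic structure is locally metallic: `J` is parallel for the Levi-Civita connection,
`∇_a (J V) = J (∇_a V)` for every vector field `V` and every tangent vector `a`. -/
def MetallicStructure.IsLocallyMetallic {E : Type*} [NormedAddCommGroup E]
    [NormedSpace ℝ E] [FiniteDimensional ℝ E] {A : Type*} [TopologicalSpace A]
    [ChartedSpace E A] [IsManifold 𝓘(ℝ, E) ∞ A] {g : SemiRiemannianMetric E A} {p q : ℕ}
    (S : MetallicStructure g p q) : Prop :=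
  ∀ V : (∀ z : A, TangentSpace 𝓘(ℝ, E) z), IsSmoothField V →
    ∀ (z : A) (a : TangentSpace 𝓘(ℝ, E) z),
      leviCivita g (fun y ↦ S.J y (V y)) z a = S.J z (leviCivita g V z a)

/-! ### Lightlike submanifolds -/

section Submanifold

variable {E : Type*} [NormedAddCommGroup E] [NormedSpace ℝ E] [FiniteDimensional ℝ E]
  {A : Type*} [TopologicalSpace A] [ChartedSpace E A]
  [IsManifold 𝓘(ℝ, E) ∞ A] (g : SemiRiemannianMetric E A)
  {F : Type*} [NormedAddCommGroup F] [NormedSpace ℝ F] 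
  {N : Type*} [TopologicalSpace N] [ChartedSpace F N]

/-- The normal space `T_x N^⊥ ⊆ T_{f x} A` of a map `f : N → A` at `x`. -/
def normalSpace (f : N → A) (x : N) : Submodule ℝ (TangentSpace 𝓘(ℝ, E) (f x)) where
  carrier := {u | ∀ w : TangentSpace 𝓘(ℝ, F) x, g.form (f x) u (mfderiv 𝓘(ℝ, F) 𝓘(ℝ, E) f x w) = 0}
  add_mem' hu hv w := by simp [hu w, hv w]
  zero_mem' w := by simp
  smul_mem' c u hu w := by simp [hu w]

/-- The radical `Rad(T_x N) = T_x N ∩ T_x N^⊥`, as a subspace of `T_x N`. -/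
def radical (f : N → A) (x : N) : Submodule ℝ (TangentSpace 𝓘(ℝ, F) x) :=
  (normalSpace (F := F) g f x).comap (mfderiv 𝓘(ℝ, F) 𝓘(ℝ, E) f x).toLinearMap

/-- A lightlike submanifold `(N, g, S(TN), S(TN^⊥))` of `(A, g)` with a lightlike transversal
bundle `ltr(TN)`: an immersed submanifold whose radical distribution has constant positive rank,
with a screen distribution, a screen transversal bundle and a lightlike transversal bundle giving
`TA|_N = S(TN) ⊥ [Rad(TN) ⊕ ltr(TN)] ⊥ S(TN^⊥)`. (Nondegeneracy of `S(TN)` and of `S(TN^⊥)` is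
automatic, as they are complements of the radical of `TN` and of `TN^⊥` respectively: see
`screen_nondegenerate` and `screenTrans_nondegenerate` below.) -/
structure LightlikeSubmanifold (F : Type*) [NormedAddCommGroup F] [NormedSpace ℝ F]
    (N : Type*) [TopologicalSpace N] [ChartedSpace F N] [IsManifold 𝓘(ℝ, F) ∞ N] where
  /-- The immersion of the submanifold. -/
  f : N → A
  contMDiff_f : ContMDiff 𝓘(ℝ, F) 𝓘(ℝ, E) ∞ f
  immersion (x : N) : Function.Injective (mfderiv 𝓘(ℝ, F) 𝓘(ℝ, E) f x)
  /-- The rank of the radical distribution. -/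
  r : ℕ
  one_le_r : 1 ≤ r
  r_le : r ≤ Module.finrank ℝ F
  finrank_radical (x : N) : Module.finrank ℝ (radical (F := F) g f x) = r
  /-- The screen distribution `S(TN)`, a complement of the radical distribution in `TN`. -/
  screen (x : N) : Submodule ℝ (TangentSpace 𝓘(ℝ, F) x)
  screen_smooth : IsSmoothSubbundleAlong (F := F) (E := F) (fun x : N ↦ x) screen
  isCompl_radical_screen (x : N) : IsCompl (radical (F := F) g f x) (screen x)
  /-- The screen transversal bundle `S(TN^⊥)`, a complement of the radical distribution
  in `TN^⊥`. -/
  screenTrans (x : N) : Submodule ℝ (TangentSpace 𝓘(ℝ, E) (f x))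
  screenTrans_smooth : IsSmoothSubbundleAlong (F := F) f screenTrans
  disjoint_radical_screenTrans (x : N) : Disjoint
    ((radical (F := F) g f x).map (mfderiv 𝓘(ℝ, F) 𝓘(ℝ, E) f x).toLinearMap) (screenTrans x)
  radical_sup_screenTrans (x : N) :
    (radical (F := F) g f x).map (mfderiv 𝓘(ℝ, F) 𝓘(ℝ, E) f x).toLinearMap ⊔ screenTrans x =
      normalSpace (F := F) g f x
  /-- The lightlike transversal bundle `ltr(TN)`: it is isotropic, orthogonal to `S(TN)` and to
  `S(TN^⊥)`, and `tr(TN) = ltr(TN) ⊕ S(TN^⊥)` is a complement of `TN` in `TA|_N`. -/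
  ltr (x : N) : Submodule ℝ (TangentSpace 𝓘(ℝ, E) (f x))
  ltr_smooth : IsSmoothSubbundleAlong (F := F) f ltr
  ltr_isotropic (x : N) : ∀ u ∈ ltr x, ∀ v ∈ ltr x, g.form (f x) u v = 0
  ltr_orthogonal_screen (x : N) : ∀ u ∈ ltr x, ∀ w ∈ screen x,
    g.form (f x) u (mfderiv 𝓘(ℝ, F) 𝓘(ℝ, E) f x w) = 0
  ltr_orthogonal_screenTrans (x : N) : ∀ u ∈ ltr x, ∀ v ∈ screenTrans x, g.form (f x) u v = 0
  isCompl_tangent_transversal (x : N) : IsCompl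
    (LinearMap.range (mfderiv 𝓘(ℝ, F) 𝓘(ℝ, E) f x).toLinearMap) (ltr x ⊔ screenTrans x)

end Submanifold

namespace LightlikeSubmanifold

variable {E : Type*} [NormedAddCommGroup E] [NormedSpace ℝ E] [FiniteDimensional ℝ E]
  {A : Type*} [TopologicalSpace A] [ChartedSpace E A]
  [IsManifold 𝓘(ℝ, E) ∞ A] {g : SemiRiemannianMetric E A}
  {F : Type*} [NormedAddCommGroup F] [NormedSpace ℝ F] 
  {N : Type*} [TopologicalSpace N] [ChartedSpace F N] [IsManifold 𝓘(ℝ, F) ∞ N]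
  (L : LightlikeSubmanifold g F N)

/-- The differential of the immersion at `x`. -/
def df (x : N) : TangentSpace 𝓘(ℝ, F) x →L[ℝ] TangentSpace 𝓘(ℝ, E) (L.f x) :=
  mfderiv 𝓘(ℝ, F) 𝓘(ℝ, E) L.f x

/-- The radical subspace `Rad(T_x N)` of `T_x N`. -/
def rad (x : N) : Submodule ℝ (TangentSpace 𝓘(ℝ, F) x) := radical (F := F) g L.f x

lemma screen_nondegenerate (x : N) (v : TangentSpace 𝓘(ℝ, F) x) (hv : v ∈ L.screen x)
    (h : ∀ w ∈ L.screen x, g.form (L.f x) (L.df x v) (L.df x w) = 0) : v = 0 := by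
  refine Submodule.disjoint_def.1 (L.isCompl_radical_screen x).disjoint v (fun w ↦ ?_) hv
  obtain ⟨a, ha, b, hb, rfl⟩ := Submodule.mem_sup.1
    ((L.isCompl_radical_screen x).sup_eq_top ▸ Submodule.mem_top (x := w))
  have h1 : g.form (L.f x) (L.df x v) (L.df x a) = 0 := by
    rw [g.symm]; exact ha v
  have h2 := h b hb
  change g.form (L.f x) (L.df x v) (L.df x (a + b)) = 0
  rw [map_add, map_add, h1, h2, add_zero]

lemma screenTrans_nondegenerate (x : N) (v : TangentSpace 𝓘(ℝ, E) (L.f x)) (hv : v ∈ L.screenTrans x)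
    (h : ∀ u ∈ L.screenTrans x, g.form (L.f x) v u = 0) : v = 0 := by
  have hsup := L.radical_sup_screenTrans x
  have hvn : v ∈ normalSpace (F := F) g L.f x := hsup ▸ Submodule.mem_sup_right hv
  have hrefl : (g.bilin (L.f x)).IsRefl := fun a b hab ↦ (g.symm _ b a).trans hab
  have hdd := LinearMap.BilinForm.orthogonal_orthogonal (g.bilin_nondegenerate (L.f x)) hrefl
    (LinearMap.range (L.df x).toLinearMap)
  have hvt : v ∈ LinearMap.range (L.df x).toLinearMap := by
    rw [← hdd, LinearMap.BilinForm.mem_orthogonal_iff]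
    intro u hu
    have hun : u ∈ normalSpace (F := F) g L.f x := fun w ↦
      (g.symm _ _ _).trans (hu _ ⟨w, rfl⟩)
    rw [← hsup] at hun
    obtain ⟨a, ⟨b, hb, rfl⟩, c, hc, rfl⟩ := Submodule.mem_sup.1 hun
    have h1 : g.form (L.f x) v (L.df x b) = 0 := hvn b
    have h2 := h c hc
    refine (g.symm _ _ _).trans ?_
    change g.form (L.f x) v (L.df x b + c) = 0
    rw [map_add, h1, h2, add_zero]
  obtain ⟨w, rfl⟩ := hvt
  exact Submodule.disjoint_def.1 (L.disjoint_radical_screenTrans x) _ ⟨w, hvn, rfl⟩ hv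

/-- The tangential component of `u ∈ T_{f x} A` in `T_{f x} A = T_x N ⊕ tr(T_x N)`, viewed as an
element of `T_x N`. -/
def tangentPart (x : N) : TangentSpace 𝓘(ℝ, E) (L.f x) →ₗ[ℝ] TangentSpace 𝓘(ℝ, F) x :=
  LinearMap.linearProjOfIsCompl (L.ltr x ⊔ L.screenTrans x) (L.df x).toLinearMap (L.immersion x)
    (L.isCompl_tangent_transversal x)

/-- The projection of `T_x N = S(T_x N) ⊕ Rad(T_x N)` onto `S(T_x N)`. -/
def screenPart (x : N) : TangentSpace 𝓘(ℝ, F) x →ₗ[ℝ] TangentSpace 𝓘(ℝ, F) x :=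
  (L.screen x).projection (radical (F := F) g L.f x) (L.isCompl_radical_screen x).symm

/-- The induced connection `∇` on `N`: the tangential part of the Levi-Civita derivative in the
Gauss formula. -/
def inducedConnection (U : ∀ x : N, TangentSpace 𝓘(ℝ, F) x) (x : N) (w : TangentSpace 𝓘(ℝ, F) x) :
    TangentSpace 𝓘(ℝ, F) x :=
  L.tangentPart x (covDerivAlong g L.f (fun y ↦ L.df y (U y)) x w)

/-- The shape operator `A_V w` of a section `V` of the transversal bundle: minus the tangential part
of the Levi-Civita derivative of `V` in the Weingarten formula. -/
def shape (V : ∀ x : N, TangentSpace 𝓘(ℝ, E) (L.f x)) (x : N) (w : TangentSpace 𝓘(ℝ, F) x) :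
    TangentSpace 𝓘(ℝ, F) x :=
  -L.tangentPart x (covDerivAlong g L.f V x w)

/-- The screen shape operator `A^*_ξ w` of a section `ξ` of the radical distribution: minus the
`S(TN)`-component of `∇_w ξ`. -/
def screenShape (ξ : ∀ x : N, TangentSpace 𝓘(ℝ, F) x) (x : N) (w : TangentSpace 𝓘(ℝ, F) x) :
    TangentSpace 𝓘(ℝ, F) x :=
  -L.screenPart x (L.inducedConnection ξ x w)

/-- `W ∈ Γ(Rad(TN))`: a smooth vector field on `N` with values in the radical distribution. -/
structure IsRadicalSection (W : ∀ x : N, TangentSpace 𝓘(ℝ, F) x) : Prop where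
  smooth : IsSmoothField W
  mem (x : N) : W x ∈ L.rad x

/-- The radical distribution is integrable (in the sense of Frobenius): the Lie bracket of two of
its sections is again one of its sections. -/
def RadicalIntegrable : Prop :=
  ∀ W U : (∀ x : N, TangentSpace 𝓘(ℝ, F) x), L.IsRadicalSection W → L.IsRadicalSection U →
    ∀ x, VectorField.mlieBracket 𝓘(ℝ, F) W U x ∈ L.rad x

variable {p q : ℕ} (S : MetallicStructure g p q)

/-- The submanifold is screen transversal: `J Rad(TN) ⊆ S(TN^⊥)`. -/
def IsScreenTransversal : Prop :=
  ∀ x, ∀ ξ ∈ L.rad x, S.J (L.f x) (L.df x ξ) ∈ L.screenTrans x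

/-- The submanifold is radical screen transversal: it is screen transversal and
`J S(TN) = S(TN)`. -/
def IsRadicalScreenTransversal : Prop :=
  L.IsScreenTransversal S ∧ ∀ x,
    ((L.screen x).map (L.df x).toLinearMap).map (S.J (L.f x)).toLinearMap =
      (L.screen x).map (L.df x).toLinearMap

/-- The section `J W` of `TA|_N`, for a vector field `W` on `N`. -/
def JAlong (W : ∀ x : N, TangentSpace 𝓘(ℝ, F) x) (x : N) : TangentSpace 𝓘(ℝ, E) (L.f x) :=
  S.J (L.f x) (L.df x (W x))

end LightlikeSubmanifold

end Lightlike

end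

/-! ### Derivatives of vector-valued functions on manifolds and their commutator. -/

section ManifoldCalculus

open VectorField

variable {E : Type*} [NormedAddCommGroup E] [NormedSpace ℝ E]
  {E' : Type*} [NormedAddCommGroup E'] [NormedSpace ℝ E']
  {F : Type*} [NormedAddCommGroup F] [NormedSpace ℝ F]
  {A : Type*} [TopologicalSpace A] [ChartedSpace E A]
  {N : Type*} [TopologicalSpace N] [ChartedSpace F N]

/-! Both conditions are statements about the single vector `[W, U]`, one pair of sections and one
point at a time. The Levi-Civita derivative along the immersion is torsion-free
(`covDerivAlong_sub_covDerivAlong`), so `A*_W U - A*_U W` is the screen part `s` of `[W, U]`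
(`screenShape_sub_screenShape`). Since `J` is parallel, also along the immersion
(`covDerivAlong_J`), `A_{JW} U - A_{JU} W` is the tangential part of `J [W, U]` (`shape_sub_shape`).

As `J` sends the radical into the transversal bundle and preserves the screen, that tangential part
is `J s` (`df_tangentPart_J`). Condition (1) therefore says `J s = p s`; applying `J` and using `J²
= p J + q I` gives `q s = 0`, so `s = 0` because `q > 0` (`tangentPart_J_eq_smul_iff`). Condition
(2) says `s = 0`, with a second clause that then holds automatically. Each condition is thus
equivalent, for each pair `W`, `U`, to `[W, U]` being radical, which gives both forms of the
theorem.

Most of the work is in deriving torsion-freeness and parallelism along a map from the coordinate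
definition of the covariant derivative. -/

lemma mvfderiv_congr_of_eventuallyEq {h k : N → E'} {x : N} (hk : h =ᶠ[nhds x] k) :
    mvfderiv 𝓘(ℝ, F) h x = mvfderiv 𝓘(ℝ, F) k x := by
  ext v
  change mfderiv 𝓘(ℝ, F) 𝓘(ℝ, E') h x v = mfderiv 𝓘(ℝ, F) 𝓘(ℝ, E') k x v
  exact congrArg (fun T : F →L[ℝ] E' ↦ T v) hk.mfderiv_eq

lemma mvfderiv_comp_vector {h : A → E'} {f : N → A} {x : N}
    (hh : MDifferentiableAt 𝓘(ℝ, E) 𝓘(ℝ, E') h (f x))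
    (hf : MDifferentiableAt 𝓘(ℝ, F) 𝓘(ℝ, E) f x) (v : TangentSpace 𝓘(ℝ, F) x) :
    mvfderiv 𝓘(ℝ, F) (fun y ↦ h (f y)) x v =
      mvfderiv 𝓘(ℝ, E) h (f x) (mfderiv 𝓘(ℝ, F) 𝓘(ℝ, E) f x v) :=
  mfderiv_comp_apply x hh hf v

lemma mvfderiv_fderiv_comp {G : E → E'} {f : N → E} {x : N}
    (hG : DifferentiableAt ℝ G (f x)) (hf : MDifferentiableAt 𝓘(ℝ, F) 𝓘(ℝ, E) f x)
    (v : TangentSpace 𝓘(ℝ, F) x) :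
    mvfderiv 𝓘(ℝ, F) (fun y ↦ G (f y)) x v = fderiv ℝ G (f x) (mvfderiv 𝓘(ℝ, F) f x v) := by
  rw [mvfderiv_comp_vector hG.mdifferentiableAt hf]
  change mfderiv 𝓘(ℝ, E) 𝓘(ℝ, E') G (f x) _ = _
  rw [mfderiv_eq_fderiv]
  rfl

lemma mvfderiv_clm_apply {c : N → E →L[ℝ] E'} {v : N → E} {x : N}
    (hc : MDifferentiableAt 𝓘(ℝ, F) 𝓘(ℝ, E →L[ℝ] E') c x)
    (hv : MDifferentiableAt 𝓘(ℝ, F) 𝓘(ℝ, E) v x) (w : TangentSpace 𝓘(ℝ, F) x) :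
    mvfderiv 𝓘(ℝ, F) (fun y ↦ c y (v y)) x w =
      mvfderiv 𝓘(ℝ, F) c x w (v x) + c x (mvfderiv 𝓘(ℝ, F) v x w) := by
  have hb : HasFDerivAt (fun p : (E →L[ℝ] E') × E ↦ p.1 p.2) _ (c x, v x) :=
    isBoundedBilinearMap_apply.hasFDerivAt (c x, v x)
  rw [mvfderiv_fderiv_comp (f := fun y ↦ (c y, v y)) hb.differentiableAt (hc.prodMk_space hv),
    hb.fderiv]
  have h1 : mvfderiv 𝓘(ℝ, F) (fun y ↦ (c y, v y)) x w =
      (mvfderiv 𝓘(ℝ, F) c x w, mvfderiv 𝓘(ℝ, F) v x w) := by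
    refine Prod.ext ?_ ?_
    · rw [show c = fun y ↦ (ContinuousLinearMap.fst ℝ (E →L[ℝ] E') E) (c y, v y) from rfl,
        mvfderiv_fderiv_comp (f := fun y ↦ (c y, v y))
          (ContinuousLinearMap.differentiableAt _) (hc.prodMk_space hv),
        ContinuousLinearMap.fderiv]
      rfl
    · rw [show v = fun y ↦ (ContinuousLinearMap.snd ℝ (E →L[ℝ] E') E) (c y, v y) from rfl,
        mvfderiv_fderiv_comp (f := fun y ↦ (c y, v y))
          (ContinuousLinearMap.differentiableAt _) (hc.prodMk_space hv),
        ContinuousLinearMap.fderiv]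
      rfl
  rw [h1]
  exact add_comm _ _

/-- The two terms in the second derivative of `h` cancel by its symmetry; what is left is `Dh`
applied to `DW V - DV W`. -/
lemma lieBracket_fderiv_apply {h : F → E'} {V W : F → F} {z : F} (hh : ContDiffAt ℝ 2 h z)
    (hV : DifferentiableAt ℝ V z) (hW : DifferentiableAt ℝ W z) :
    fderiv ℝ (fun y ↦ fderiv ℝ h y (W y)) z (V z) - fderiv ℝ (fun y ↦ fderiv ℝ h y (V y)) z (W z) =
      fderiv ℝ h z (lieBracket ℝ V W z) := by
  have hd : DifferentiableAt ℝ (fderiv ℝ h) z :=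
    (hh.fderiv_right (m := 1) (by norm_num)).differentiableAt one_ne_zero
  have hs : IsSymmSndFDerivAt ℝ h z := hh.isSymmSndFDerivAt (by simp)
  rw [fderiv_clm_apply hd hV, fderiv_clm_apply hd hW]
  simp [lieBracket, hs.eq (V z) (W z)]

variable [CompleteSpace F] [IsManifold 𝓘(ℝ, F) ∞ N]

/-- The bracket acts on functions as the commutator of derivations. Both sides are transported by
the chart at `x` to the model space, where `lieBracket_fderiv_apply` applies. -/
lemma mlieBracket_mvfderiv_apply {h : N → E'} {V W : ∀ x : N, TangentSpace 𝓘(ℝ, F) x} {x : N}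
    (hh : ContMDiffAt 𝓘(ℝ, F) 𝓘(ℝ, E') ∞ h x)
    (hV : ContMDiffAt 𝓘(ℝ, F) 𝓘(ℝ, F).tangent ∞ (fun y ↦ (⟨y, V y⟩ : TangentBundle 𝓘(ℝ, F) N)) x)
    (hW : ContMDiffAt 𝓘(ℝ, F) 𝓘(ℝ, F).tangent ∞ (fun y ↦ (⟨y, W y⟩ : TangentBundle 𝓘(ℝ, F) N)) x) :
    mvfderiv 𝓘(ℝ, F) (fun y ↦ mvfderiv 𝓘(ℝ, F) h y (W y)) x (V x) -
        mvfderiv 𝓘(ℝ, F) (fun y ↦ mvfderiv 𝓘(ℝ, F) h y (V y)) x (W x) =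
      mvfderiv 𝓘(ℝ, F) h x (mlieBracket 𝓘(ℝ, F) V W x) := by
  set φ := extChartAt 𝓘(ℝ, F) x with hφ
  let pull (V : ∀ x : N, TangentSpace 𝓘(ℝ, F) x) : F → F :=
    mpullbackWithin 𝓘(ℝ, F) 𝓘(ℝ, F) φ.symm V (Set.range 𝓘(ℝ, F))
  let k : F → E' := fun z ↦ h (φ.symm z)
  have h2 : (2 : WithTop ℕ∞) ≤ ∞ := WithTop.coe_le_coe.2 le_top
  have hφx : φ.symm (φ x) = x := extChartAt_to_inv x
  have hk : ContDiffAt ℝ ∞ k (φ x) := by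
    rw [← contMDiffAt_iff_contDiffAt]
    refine ContMDiffAt.comp (φ x) (I' := 𝓘(ℝ, F)) (g := h) (f := φ.symm) (hφx.symm ▸ hh) ?_
    have := contMDiffWithinAt_extChartAt_symm_range (I := 𝓘(ℝ, F)) (n := ∞) x
      (mem_extChartAt_target x)
    rwa [modelWithCornersSelf_coe, Set.range_id, contMDiffWithinAt_univ] at this
  have hpull {V : ∀ x : N, TangentSpace 𝓘(ℝ, F) x} (hV : ContMDiffAt 𝓘(ℝ, F) 𝓘(ℝ, F).tangent ∞
      (fun y ↦ (⟨y, V y⟩ : TangentBundle 𝓘(ℝ, F) N)) x) : DifferentiableAt ℝ (pull V) (φ x) := by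
    have : IsManifold 𝓘(ℝ, F) 2 N := inferInstance
    have := (hV.mdifferentiableAt (by simp)).mdifferentiableWithinAt
      (s := Set.univ) |>.differentiableWithinAt_mpullbackWithin_vectorField
    rw [modelWithCornersSelf_coe, Set.preimage_univ, Set.range_id, Set.inter_univ] at this
    refine (differentiableWithinAt_univ (f := pull V)).1 ?_
    convert this using 1
    simp only [pull, modelWithCornersSelf_coe, Set.range_id]
    rfl
  have hφd {y : N} (hy : y ∈ φ.source) : MDifferentiableAt 𝓘(ℝ, F) 𝓘(ℝ, F) φ y :=
    mdifferentiableAt_extChartAt (by simpa [hφ] using hy)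
  -- The pulled-back field is the push-forward of `V` under the chart, because the differentials of
  -- the chart and of its inverse are mutually inverse.
  have hval (V : ∀ x : N, TangentSpace 𝓘(ℝ, F) x) {y : N} (hy : y ∈ φ.source) :
      mvfderiv 𝓘(ℝ, F) φ y (V y) = pull V (φ y) := by
    have hinv : (mfderiv 𝓘(ℝ, F) 𝓘(ℝ, F) φ y).IsInvertible := isInvertible_mfderiv_extChartAt hy
    have h1 : (mfderiv 𝓘(ℝ, F) 𝓘(ℝ, F) φ y).inverse (pull V (φ y)) = V y := by
      change (mfderiv 𝓘(ℝ, F) 𝓘(ℝ, F) φ y).inverse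
        (mpullbackWithin 𝓘(ℝ, F) 𝓘(ℝ, F) φ.symm V (Set.range 𝓘(ℝ, F)) (φ y)) = V y
      rw [mpullbackWithin_apply,
        ← (isInvertible_mfderiv_extChartAt hy).inverse_comp_apply_of_right,
        mfderivWithin_extChartAt_symm_comp_mfderiv_extChartAt' hy, φ.left_inv hy,
        ContinuousLinearMap.inverse_id]
      rfl
    exact ((hinv.inverse_apply_eq).1 h1).symm
  have hder {y : N} (hy : y ∈ φ.source) (hdk : DifferentiableAt ℝ k (φ y))
      (v : TangentSpace 𝓘(ℝ, F) y) :
      mvfderiv 𝓘(ℝ, F) h y v = fderiv ℝ k (φ y) (mvfderiv 𝓘(ℝ, F) φ y v) := by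
    rw [← mvfderiv_fderiv_comp hdk (hφd hy)]
    refine congrArg (fun T : F →L[ℝ] E' ↦ T v) (mvfderiv_congr_of_eventuallyEq ?_)
    filter_upwards [(isOpen_extChartAt_source x).mem_nhds hy] with y' hy'
    exact congrArg h (φ.left_inv hy').symm
  have hx : x ∈ φ.source := mem_extChartAt_source x
  have hdk : ∀ᶠ y in nhds x, DifferentiableAt ℝ k (φ y) := by
    have := (hk.of_le (m := 1) (by simp)).eventually (by simp)
    exact ((continuousAt_extChartAt x).eventually this).mono
      fun y hy ↦ hy.differentiableAt one_ne_zero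
  have hsec {V W : ∀ x : N, TangentSpace 𝓘(ℝ, F) x} 
      (hW : DifferentiableAt ℝ (pull W) (φ x)) :
      mvfderiv 𝓘(ℝ, F) (fun y ↦ mvfderiv 𝓘(ℝ, F) h y (W y)) x (V x) =
        fderiv ℝ (fun z ↦ fderiv ℝ k z (pull W z)) (φ x) (pull V (φ x)) := by
    have hev : (fun y ↦ mvfderiv 𝓘(ℝ, F) h y (W y)) =ᶠ[nhds x]
        fun y ↦ (fun z ↦ fderiv ℝ k z (pull W z)) (φ y) := by
      filter_upwards [hdk, (isOpen_extChartAt_source x).mem_nhds hx] with y hy hy'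
      rw [hder hy' hy, hval W hy']
    rw [mvfderiv_congr_of_eventuallyEq hev,
      mvfderiv_fderiv_comp (G := fun z ↦ fderiv ℝ k z (pull W z)) _ (hφd hx), hval V hx]
    exact (((hk.of_le h2).fderiv_right (m := 1) (by norm_num)).differentiableAt one_ne_zero).clm_apply hW
  rw [hsec (hpull hW), hsec (hpull hV), lieBracket_fderiv_apply (hk.of_le h2) (hpull hV)
    (hpull hW), hder hx hdk.self_of_nhds]
  congr 1
  have hinv : (mfderiv 𝓘(ℝ, F) 𝓘(ℝ, F) φ x).IsInvertible := isInvertible_mfderiv_extChartAt hx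
  -- By definition the manifold bracket is the pullback of the bracket of the fields read in the
  -- chart; with no boundary, the set it is taken within is everything.
  have h1 : mlieBracket 𝓘(ℝ, F) V W x = (mfderiv 𝓘(ℝ, F) 𝓘(ℝ, F) φ x).inverse
      (lieBracket ℝ (pull V) (pull W) (φ x) : F) := by
    have hset : φ.symm ⁻¹' Set.univ ∩ Set.range 𝓘(ℝ, F) = Set.univ := by simp
    rw [← lieBracketWithin_univ, ← hset]
    rfl
  exact ((hinv.inverse_apply_eq).1 h1.symm).trans rfl

end ManifoldCalculus

noncomputable section

namespace Lightlike

open VectorField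

/-! ### Torsion-freeness of the Levi-Civita derivative along a map. -/

section LeviCivita

variable {E : Type*} [NormedAddCommGroup E] [NormedSpace ℝ E] [FiniteDimensional ℝ E]
  {A : Type*} [TopologicalSpace A] [ChartedSpace E A]
  [IsManifold 𝓘(ℝ, E) ∞ A]
  {F : Type*} [NormedAddCommGroup F] [NormedSpace ℝ F]
  {N : Type*} [TopologicalSpace N] [ChartedSpace F N]

lemma ofCoord_toCoord {z y : A} (hy : y ∈ (chartAt E z).source) (v : TangentSpace 𝓘(ℝ, E) y) :
    ofCoord z y (toCoord z y v) = v :=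
  (trivializationAt E (TangentSpace 𝓘(ℝ, E)) z).symmL_continuousLinearMapAt
    (by simpa using hy) v

lemma toCoord_ofCoord {z y : A} (hy : y ∈ (chartAt E z).source) (v : E) :
    toCoord z y (ofCoord z y v) = v :=
  (trivializationAt E (TangentSpace 𝓘(ℝ, E)) z).continuousLinearMapAt_symmL
    (by simpa using hy) v

lemma toCoord_eq_mvfderiv {z y : A} (hy : y ∈ (chartAt E z).source) (v : TangentSpace 𝓘(ℝ, E) y) :
    toCoord z y v = mvfderiv 𝓘(ℝ, E) (extChartAt 𝓘(ℝ, E) z) y v :=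
  congrArg (fun T : TangentSpace 𝓘(ℝ, E) y →L[ℝ] E ↦ T v)
    (TangentBundle.continuousLinearMapAt_trivializationAt hy)

namespace SemiRiemannianMetric

variable (g : SemiRiemannianMetric E A)

lemma dCoordForm_symm (z : A) (a : TangentSpace 𝓘(ℝ, E) z) (b d : E) :
    g.dCoordForm z a b d = g.dCoordForm z a d b := by
  by_cases hG : MDifferentiableAt 𝓘(ℝ, E) 𝓘(ℝ, E →L[ℝ] E →L[ℝ] ℝ) (g.coordForm z) z
  · have hconst (b : E) : MDifferentiableAt 𝓘(ℝ, E) 𝓘(ℝ, E) (fun _ : A ↦ b) z :=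
      mdifferentiableAt_const
    have heval (b d : E) : mvfderiv 𝓘(ℝ, E) (fun y ↦ g.coordForm z y b d) z a =
        g.dCoordForm z a b d := by
      rw [mvfderiv_clm_apply (hG.clm_apply (hconst b)) (hconst d),
        mvfderiv_clm_apply hG (hconst b), mvfderiv_const, mvfderiv_const,
        zero_apply, map_zero, map_zero, add_zero, add_zero]
      rfl
    rw [← heval, ← heval]
    congr 2
    exact funext fun y ↦ g.symm _ _ _
  -- Without differentiability the derivative is zero by convention, so the symmetry persists and no
  -- smoothness of the coefficients has to be shown.
  · have h : g.dCoordForm z a = 0 := by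
      change mfderiv 𝓘(ℝ, E) 𝓘(ℝ, E →L[ℝ] E →L[ℝ] ℝ) (g.coordForm z) z a = 0
      rw [mfderiv_zero_of_not_mdifferentiableAt hG]
      rfl
    rw [h]
    rfl

lemma christoffel_symm (z : A) (a b : TangentSpace 𝓘(ℝ, E) z) :
    g.christoffel z a b = g.christoffel z b a := by
  have h : g.christoffelFirst z a b = g.christoffelFirst z b a := by
    refine LinearMap.ext fun d ↦ ?_
    change (1 / 2 : ℝ) * (_ + _ - _) = (1 / 2 : ℝ) * (_ + _ - _)
    rw [g.dCoordForm_symm z d]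
    ring
  rw [christoffel, h, christoffel]

end SemiRiemannianMetric

variable (g : SemiRiemannianMetric E A)

lemma eventually_mem_chartAt_source {f : N → A} {x : N} (hf : ContinuousAt f x) :
    ∀ᶠ y in nhds x, f y ∈ (chartAt E (f x)).source :=
  hf.eventually ((chartAt E (f x)).open_source.mem_nhds (mem_chart_source E (f x)))

/-- In a chart `φ` at `f x`, the components of `df W` are the derivative of `φ ∘ f` along `W`. The
Christoffel terms cancel by symmetry, and the remaining commutator of derivatives of `φ ∘ f` is its
derivative along the bracket. -/
lemma covDerivAlong_sub_covDerivAlong [CompleteSpace F] [IsManifold 𝓘(ℝ, F) ∞ N] {f : N → A}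
    (hf : ContMDiff 𝓘(ℝ, F) 𝓘(ℝ, E) ∞ f) {V W : ∀ x : N, TangentSpace 𝓘(ℝ, F) x}
    (hV : IsSmoothField V) (hW : IsSmoothField W) (x : N) :
    covDerivAlong g f (fun y ↦ mfderiv 𝓘(ℝ, F) 𝓘(ℝ, E) f y (W y)) x (V x) -
        covDerivAlong g f (fun y ↦ mfderiv 𝓘(ℝ, F) 𝓘(ℝ, E) f y (V y)) x (W x) =
      mfderiv 𝓘(ℝ, F) 𝓘(ℝ, E) f x (mlieBracket 𝓘(ℝ, F) V W x) := by
  let φ := extChartAt 𝓘(ℝ, E) (f x)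
  have hfd (y : N) : MDifferentiableAt 𝓘(ℝ, F) 𝓘(ℝ, E) f y := hf.mdifferentiableAt (by simp)
  have hφf {y : N} (hy : f y ∈ (chartAt E (f x)).source) (v : TangentSpace 𝓘(ℝ, F) y) :
      toCoord (f x) (f y) (mfderiv 𝓘(ℝ, F) 𝓘(ℝ, E) f y v) =
        mvfderiv 𝓘(ℝ, F) (fun y ↦ φ (f y)) y v := by
    rw [toCoord_eq_mvfderiv hy, mvfderiv_comp_vector (mdifferentiableAt_extChartAt hy) (hfd y)]
  have hcoord (V : ∀ x : N, TangentSpace 𝓘(ℝ, F) x) :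
      mvfderiv 𝓘(ℝ, F) (fun y ↦ toCoord (f x) (f y) (mfderiv 𝓘(ℝ, F) 𝓘(ℝ, E) f y (V y))) x =
        mvfderiv 𝓘(ℝ, F) (fun y ↦ mvfderiv 𝓘(ℝ, F) (fun y ↦ φ (f y)) y (V y)) x := by
    refine mvfderiv_congr_of_eventuallyEq ?_
    filter_upwards [eventually_mem_chartAt_source (E := E) hf.continuous.continuousAt]
      with y hy using hφf hy (V y)
  have hφfs : ContMDiffAt 𝓘(ℝ, F) 𝓘(ℝ, E) ∞ (fun y ↦ φ (f y)) x :=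
    contMDiffAt_extChartAt.comp x hf.contMDiffAt
  rw [covDerivAlong, covDerivAlong, hcoord, hcoord, g.christoffel_symm, add_sub_add_right_eq_sub,
    ← map_sub, mlieBracket_mvfderiv_apply hφfs hV.contMDiffAt hW.contMDiffAt,
    ← hφf (mem_chart_source E (f x)), ofCoord_toCoord (mem_chart_source E (f x))]

end LeviCivita

/-! ### Parallelism of `J` for vector fields along a map. -/

section Parallel

variable {E : Type*} [NormedAddCommGroup E] [NormedSpace ℝ E] [FiniteDimensional ℝ E]
  {A : Type*} [TopologicalSpace A] [ChartedSpace E A]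
  [IsManifold 𝓘(ℝ, E) ∞ A] {g : SemiRiemannianMetric E A}
  {F : Type*} [NormedAddCommGroup F] [NormedSpace ℝ F]
  {N : Type*} [TopologicalSpace N] [ChartedSpace F N] {p q : ℕ}

lemma IsSmoothAlongAt.mdifferentiableAt_toCoord {f : N → A}
    {V : ∀ x, TangentSpace 𝓘(ℝ, E) (f x)} {x : N} (hV : IsSmoothAlongAt (F := F) f V x) :
    MDifferentiableAt 𝓘(ℝ, F) 𝓘(ℝ, E) (fun y ↦ toCoord (f x) (f y) (V y)) x := by
  obtain ⟨h1, h2⟩ := Bundle.contMDiffAt_totalSpace.1 hV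
  refine (h2.mdifferentiableAt (by simp)).congr_of_eventuallyEq ?_
  filter_upwards [eventually_mem_chartAt_source (E := E) h1.continuousAt] with y hy
  have hy' : f y ∈ (trivializationAt E (TangentSpace 𝓘(ℝ, E) (M := A)) (f x)).baseSet := by
    simpa using hy
  exact Bundle.Trivialization.continuousLinearMapAt_apply_of_mem ℝ _ hy' _

/-- Being locally metallic is a condition on global fields; a bump function turns a field with
constant components in a chart into a global one to test it on. -/
lemma exists_smooth_field_eventually_ofCoord [T2Space A] (z : A) (v : E) :
    ∃ V : (∀ y : A, TangentSpace 𝓘(ℝ, E) y), IsSmoothField V ∧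
      ∀ᶠ y in nhds z, V y = ofCoord z y v := by
  obtain ⟨ψ⟩ : Nonempty (SmoothBumpFunction 𝓘(ℝ, E) z) := inferInstance
  refine ⟨(ψ : A → ℝ) • fun y ↦ ofCoord z y v, ?_, ?_⟩
  · refine ContMDiffOn.smul_section_of_tsupport (u := (chartAt E z).source)
      ψ.contMDiff.contMDiffOn (chartAt E z).open_source ψ.tsupport_subset_chartAt_source ?_
    have hbase : (trivializationAt E (TangentSpace 𝓘(ℝ, E)) z).baseSet = (chartAt E z).source := by
      simp
    intro y hy
    rw [← hbase] at hy ⊢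
    rw [(trivializationAt E (TangentSpace 𝓘(ℝ, E)) z).contMDiffWithinAt_section _ hy]
    have hconst (y') (hy' : y' ∈ (trivializationAt E (TangentSpace 𝓘(ℝ, E)) z).baseSet) :
        (trivializationAt E (TangentSpace 𝓘(ℝ, E)) z ⟨y', ofCoord z y' v⟩).2 = v := by
      rw [← Bundle.Trivialization.continuousLinearMapAt_apply_of_mem ℝ _ hy']
      exact toCoord_ofCoord (by simpa using hy') v
    exact (contMDiffWithinAt_const (c := v)).congr hconst (hconst y hy)
  · filter_upwards [ψ.eventuallyEq_one] with y hy
    simp [hy]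

namespace MetallicStructure

variable (S : MetallicStructure g p q)

/-- The components of `J` near `z`, in the preferred chart around `z`. -/
def coordJ (z y : A) : E →L[ℝ] E := toCoord z y ∘L S.J y ∘L ofCoord z y

lemma mdifferentiableAt_coordJ (z : A) :
    MDifferentiableAt 𝓘(ℝ, E) 𝓘(ℝ, E →L[ℝ] E) (S.coordJ z) z :=
  ((contMDiffAt_hom_bundle _).1 (S.contMDiff z)).2.mdifferentiableAt (by simp)

lemma toCoord_J {z y : A} (hy : y ∈ (chartAt E z).source) (v : TangentSpace 𝓘(ℝ, E) y) :
    toCoord z y (S.J y v) = S.coordJ z y (toCoord z y v) := by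
  change _ = toCoord z y (S.J y (ofCoord z y (toCoord z y v)))
  rw [ofCoord_toCoord hy]

variable {S}

/-- This is `∇J = 0` in coordinates. On a field with constant components near `z` the derivative of
the components vanishes, leaving only the derivative of `J` and the Christoffel terms. -/
lemma IsLocallyMetallic.ofCoord_mvfderiv_coordJ [T2Space A] (hS : S.IsLocallyMetallic) (z : A)
    (a v : TangentSpace 𝓘(ℝ, E) z) :
    ofCoord z z (mvfderiv 𝓘(ℝ, E) (S.coordJ z) z a (toCoord z z v)) +
      g.christoffel z a (S.J z v) = S.J z (g.christoffel z a v) := by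
  obtain ⟨V, hV, hVz⟩ := exists_smooth_field_eventually_ofCoord z (toCoord z z v)
  have hz := mem_chart_source E z
  have hVv : V z = v := hVz.self_of_nhds.trans (ofCoord_toCoord hz v)
  have hsrc : ∀ᶠ y in nhds z, y ∈ (chartAt E z).source :=
    (chartAt E z).open_source.mem_nhds hz
  have hcV : (fun y ↦ toCoord z y (V y)) =ᶠ[nhds z] fun _ ↦ toCoord z z v := by
    filter_upwards [hVz, hsrc] with y hy hy'
    rw [hy, toCoord_ofCoord hy']
  have hcJ : (fun y ↦ toCoord z y (S.J y (V y))) =ᶠ[nhds z]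
      fun y ↦ S.coordJ z y (toCoord z z v) := by
    filter_upwards [hcV, hsrc] with y hy hy'
    rw [S.toCoord_J hy', hy]
  have h := hS V hV z a
  have hid : mfderiv 𝓘(ℝ, E) 𝓘(ℝ, E) (fun y : A ↦ y) z a = a := by
    rw [show (fun y : A ↦ y) = id from rfl, mfderiv_id]
    rfl
  rw [leviCivita, leviCivita, covDerivAlong, covDerivAlong, hid, hVv,
    mvfderiv_congr_of_eventuallyEq hcV, mvfderiv_congr_of_eventuallyEq hcJ,
    mvfderiv_clm_apply (S.mdifferentiableAt_coordJ z) mdifferentiableAt_const, mvfderiv_const] at h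
  simpa using h

/-- A field along `f` need not come from a field on `A`, so the hypothesis does not apply directly.
The product rule in coordinates reduces the claim to the pointwise identity
`ofCoord_mvfderiv_coordJ` in the direction `df w`. -/
lemma IsLocallyMetallic.covDerivAlong_J [T2Space A] (hS : S.IsLocallyMetallic) {f : N → A}
    {V : ∀ x, TangentSpace 𝓘(ℝ, E) (f x)} {x : N}
    (hf : MDifferentiableAt 𝓘(ℝ, F) 𝓘(ℝ, E) f x) (hV : IsSmoothAlongAt (F := F) f V x)
    (w : TangentSpace 𝓘(ℝ, F) x) :
    covDerivAlong g f (fun y ↦ S.J (f y) (V y)) x w = S.J (f x) (covDerivAlong g f V x w) := by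
  have hc : (fun y ↦ toCoord (f x) (f y) (S.J (f y) (V y))) =ᶠ[nhds x]
      fun y ↦ S.coordJ (f x) (f y) (toCoord (f x) (f y) (V y)) := by
    filter_upwards [eventually_mem_chartAt_source (E := E) hf.continuousAt] with y hy
      using S.toCoord_J hy _
  have hJ (u : E) : ofCoord (f x) (f x) (S.coordJ (f x) (f x) u) =
      S.J (f x) (ofCoord (f x) (f x) u) :=
    ofCoord_toCoord (mem_chart_source E (f x)) _
  rw [covDerivAlong, covDerivAlong, mvfderiv_congr_of_eventuallyEq hc,
    mvfderiv_clm_apply (c := fun y ↦ S.coordJ (f x) (f y))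
      ((S.mdifferentiableAt_coordJ (f x)).comp x hf)
      hV.mdifferentiableAt_toCoord, mvfderiv_comp_vector (S.mdifferentiableAt_coordJ (f x)) hf,
    map_add, map_add, hJ, ← hS.ofCoord_mvfderiv_coordJ (f x)]
  abel

end MetallicStructure

end Parallel

end Lightlike

/-! ### Shape operators and the bracket on a radical screen transversal submanifold. -/

namespace Lightlike.LightlikeSubmanifold

open VectorField

variable {E : Type*} [NormedAddCommGroup E] [NormedSpace ℝ E] [FiniteDimensional ℝ E]
  {A : Type*} [TopologicalSpace A] [ChartedSpace E A]
  [IsManifold 𝓘(ℝ, E) ∞ A] {g : SemiRiemannianMetric E A}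
  {F : Type*} [NormedAddCommGroup F] [NormedSpace ℝ F]
  {N : Type*} [TopologicalSpace N] [ChartedSpace F N] [IsManifold 𝓘(ℝ, F) ∞ N]
  (L : LightlikeSubmanifold g F N) {p q : ℕ} {S : MetallicStructure g p q}

lemma tangentPart_df (x : N) (w : TangentSpace 𝓘(ℝ, F) x) : L.tangentPart x (L.df x w) = w :=
  LinearMap.linearProjOfIsCompl_apply_left _ (L.df x).toLinearMap (L.immersion x)
    (L.isCompl_tangent_transversal x) w

lemma tangentPart_of_mem_screenTrans (x : N) {u : TangentSpace 𝓘(ℝ, E) (L.f x)}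
    (hu : u ∈ L.screenTrans x) : L.tangentPart x u = 0 :=
  LinearMap.linearProjOfIsCompl_apply_right' _ (L.df x).toLinearMap (L.immersion x)
    (L.isCompl_tangent_transversal x) u (Submodule.mem_sup_right hu)

lemma screenPart_mem (x : N) (w : TangentSpace 𝓘(ℝ, F) x) : L.screenPart x w ∈ L.screen x :=
  Submodule.projection_apply_mem _ w

lemma screenPart_eq_zero_iff (x : N) {w : TangentSpace 𝓘(ℝ, F) x} :
    L.screenPart x w = 0 ↔ w ∈ L.rad x :=
  Submodule.projection_apply_eq_zero_iff _

lemma sub_screenPart_mem_rad (x : N) (w : TangentSpace 𝓘(ℝ, F) x) :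
    w - L.screenPart x w ∈ L.rad x := by
  rw [← L.screenPart_eq_zero_iff, map_sub, sub_eq_zero]
  exact (Submodule.projection_apply_of_mem_left _ (L.screenPart_mem x w)).symm

lemma isSmoothAlongAt_df {W : ∀ x : N, TangentSpace 𝓘(ℝ, F) x} (hW : IsSmoothField W) (x : N) :
    IsSmoothAlongAt (F := F) L.f (fun y ↦ L.df y (W y)) x :=
  (L.contMDiff_f.contMDiff_tangentMap (m := ∞) (by simp)).contMDiffAt.comp x hW.contMDiffAt

section

variable [CompleteSpace F] {V W : ∀ x : N, TangentSpace 𝓘(ℝ, F) x}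

lemma screenShape_sub_screenShape (hV : IsSmoothField V) (hW : IsSmoothField W) (x : N) :
    L.screenShape V x (W x) - L.screenShape W x (V x) =
      L.screenPart x (mlieBracket 𝓘(ℝ, F) V W x) := by
  rw [screenShape, screenShape, neg_sub_neg, ← map_sub, inducedConnection, inducedConnection,
    ← map_sub]
  congr 1
  exact (congrArg _ (covDerivAlong_sub_covDerivAlong g L.contMDiff_f hV hW x)).trans
    (L.tangentPart_df x _)

lemma shape_sub_shape [T2Space A] (hS : S.IsLocallyMetallic)
    (hV : IsSmoothField V) (hW : IsSmoothField W) (x : N) :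
    L.shape (L.JAlong S V) x (W x) - L.shape (L.JAlong S W) x (V x) =
      L.tangentPart x (S.J (L.f x) (L.df x (mlieBracket 𝓘(ℝ, F) V W x))) := by
  have hf : MDifferentiableAt 𝓘(ℝ, F) 𝓘(ℝ, E) L.f x := L.contMDiff_f.mdifferentiableAt (by simp)
  rw [shape, shape, neg_sub_neg, ← map_sub]
  unfold JAlong
  rw [hS.covDerivAlong_J hf (L.isSmoothAlongAt_df hV x),
    hS.covDerivAlong_J hf (L.isSmoothAlongAt_df hW x), ← map_sub]
  congr 2
  exact covDerivAlong_sub_covDerivAlong g L.contMDiff_f hV hW x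

end

variable {L}

lemma IsRadicalScreenTransversal.exists_screen_J (hL : L.IsRadicalScreenTransversal S) (x : N)
    {w : TangentSpace 𝓘(ℝ, F) x} (hw : w ∈ L.screen x) :
    ∃ u ∈ L.screen x, S.J (L.f x) (L.df x w) = L.df x u := by
  have h : S.J (L.f x) (L.df x w) ∈ (L.screen x).map (L.df x).toLinearMap :=
    hL.2 x ▸ Submodule.mem_map_of_mem (Submodule.mem_map_of_mem hw)
  obtain ⟨u, hu, h⟩ := h
  exact ⟨u, hu, h.symm⟩

/-- Split `w` into screen and radical parts: `J` keeps the first tangent, in the screen, and makes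
the second transversal, so only the screen part contributes. -/
lemma IsRadicalScreenTransversal.df_tangentPart_J (hL : L.IsRadicalScreenTransversal S) (x : N)
    (w : TangentSpace 𝓘(ℝ, F) x) :
    L.tangentPart x (S.J (L.f x) (L.df x w)) ∈ L.screen x ∧
      L.df x (L.tangentPart x (S.J (L.f x) (L.df x w))) =
        S.J (L.f x) (L.df x (L.screenPart x w)) := by
  obtain ⟨u, hu, h⟩ := hL.exists_screen_J x (L.screenPart_mem x w)
  have hr := L.tangentPart_of_mem_screenTrans x (hL.1 x _ (L.sub_screenPart_mem_rad x w))
  rw [map_sub, map_sub, map_sub, h, L.tangentPart_df, sub_eq_zero] at hr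
  rw [hr, h]
  exact ⟨hu, rfl⟩

/-- With `s` the screen part of `w`, the equation reads `J s = p s`. Its only solution is `s = 0`,
since the roots of `t² = p t + q` do not include `p` when `q ≠ 0`. -/
lemma IsRadicalScreenTransversal.tangentPart_J_eq_smul_iff (hL : L.IsRadicalScreenTransversal S)
    (x : N) (w : TangentSpace 𝓘(ℝ, F) x) :
    L.tangentPart x (S.J (L.f x) (L.df x w)) = (p : ℝ) • L.screenPart x w ↔ w ∈ L.rad x := by
  obtain ⟨-, h⟩ := hL.df_tangentPart_J x w
  rw [← L.screenPart_eq_zero_iff]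
  constructor
  · intro hp
    rw [hp, map_smul] at h
    have hm := S.metallic (L.f x) (L.df x (L.screenPart x w))
    -- Substituting `J s = p s` twice in `J² s = p J s + q s` gives `p² s = p² s + q s`.
    rw [← h, map_smul, ← h, left_eq_add, smul_eq_zero] at hm
    have hq : (q : ℝ) ≠ 0 := by exact_mod_cast S.q_pos.ne'
    exact L.immersion x ((hm.resolve_left hq).trans (map_zero (L.df x)).symm)
  · intro h0
    rw [h0, map_zero, map_zero] at h
    rw [h0, smul_zero]
    exact L.immersion x (h.trans (map_zero (L.df x)).symm)

lemma IsRadicalScreenTransversal.tangentPart_J_eq_zero (hL : L.IsRadicalScreenTransversal S)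
    (x : N) {w : TangentSpace 𝓘(ℝ, F) x} (hw : w ∈ L.rad x) :
    L.tangentPart x (S.J (L.f x) (L.df x w)) = 0 :=
  L.tangentPart_of_mem_screenTrans x (hL.1 x w hw)

end Lightlike.LightlikeSubmanifold

end

theorem mainTheorem10 {p q : ℕ}
    {E : Type*} [NormedAddCommGroup E] [NormedSpace ℝ E] [FiniteDimensional ℝ E]
    {A : Type*} [TopologicalSpace A] [T2Space A] [SecondCountableTopology A]
    [ChartedSpace E A] [IsManifold 𝓘(ℝ, E) ∞ A]
    {g : Lightlike.SemiRiemannianMetric E A} (S : Lightlike.MetallicStructure g p q)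
    (hS : S.IsLocallyMetallic)
    {F : Type*} [NormedAddCommGroup F] [NormedSpace ℝ F] [FiniteDimensional ℝ F]
    {N : Type*} [TopologicalSpace N] [T2Space N] [SecondCountableTopology N]
    [ChartedSpace F N] [IsManifold 𝓘(ℝ, F) ∞ N]
    (L : Lightlike.LightlikeSubmanifold g F N) (hL : L.IsRadicalScreenTransversal S) :
    (L.RadicalIntegrable ↔
      (∀ W U : (∀ x : N, TangentSpace 𝓘(ℝ, F) x), L.IsRadicalSection W → L.IsRadicalSection U →
        ∀ x, L.shape (L.JAlong S W) x (U x) - L.shape (L.JAlong S U) x (W x) =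
          (p : ℝ) • (L.screenShape W x (U x) - L.screenShape U x (W x))) ∨
      (∀ W U : (∀ x : N, TangentSpace 𝓘(ℝ, F) x), L.IsRadicalSection W → L.IsRadicalSection U →
        (∀ x, L.screenShape W x (U x) = L.screenShape U x (W x)) ∧
        ∀ x, L.shape (L.JAlong S W) x (U x) - L.shape (L.JAlong S U) x (W x) ∈ L.rad x)) ∧
    (L.RadicalIntegrable ↔
      ∀ W U : (∀ x : N, TangentSpace 𝓘(ℝ, F) x), L.IsRadicalSection W → L.IsRadicalSection U →
        (∀ x, L.shape (L.JAlong S W) x (U x) - L.shape (L.JAlong S U) x (W x) =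
          (p : ℝ) • (L.screenShape W x (U x) - L.screenShape U x (W x))) ∨
        ((∀ x, L.screenShape W x (U x) = L.screenShape U x (W x)) ∧
          ∀ x, L.shape (L.JAlong S W) x (U x) - L.shape (L.JAlong S U) x (W x) ∈ L.rad x)) := by
  have : CompleteSpace F := FiniteDimensional.complete ℝ F
  have h1 {W U : ∀ x : N, TangentSpace 𝓘(ℝ, F) x} (hW : L.IsRadicalSection W)
      (hU : L.IsRadicalSection U) :
      (∀ x, L.shape (L.JAlong S W) x (U x) - L.shape (L.JAlong S U) x (W x) =
          (p : ℝ) • (L.screenShape W x (U x) - L.screenShape U x (W x))) ↔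
        ∀ x, VectorField.mlieBracket 𝓘(ℝ, F) W U x ∈ L.rad x := by
    refine forall_congr' fun x ↦ ?_
    rw [L.shape_sub_shape hS hW.smooth hU.smooth, L.screenShape_sub_screenShape hW.smooth hU.smooth,
      hL.tangentPart_J_eq_smul_iff]
  have h2 {W U : ∀ x : N, TangentSpace 𝓘(ℝ, F) x} (hW : L.IsRadicalSection W)
      (hU : L.IsRadicalSection U) :
      ((∀ x, L.screenShape W x (U x) = L.screenShape U x (W x)) ∧
          ∀ x, L.shape (L.JAlong S W) x (U x) - L.shape (L.JAlong S U) x (W x) ∈ L.rad x) ↔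
        ∀ x, VectorField.mlieBracket 𝓘(ℝ, F) W U x ∈ L.rad x := by
    rw [← forall_and]
    refine forall_congr' fun x ↦ ?_
    rw [L.shape_sub_shape hS hW.smooth hU.smooth, ← sub_eq_zero,
      L.screenShape_sub_screenShape hW.smooth hU.smooth, L.screenPart_eq_zero_iff]
    -- Once the bracket is radical, `J` sends it into the screen transversal bundle, so the
    -- difference of shape operators is zero and the second clause is redundant.
    refine and_iff_left_of_imp fun h ↦ ?_
    rw [hL.tangentPart_J_eq_zero x h]
    exact Submodule.zero_mem _
  refine ⟨⟨fun h ↦ Or.inl fun W U hW hU ↦ (h1 hW hU).2 (h W U hW hU), ?_⟩,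
    fun h W U hW hU ↦ Or.inl ((h1 hW hU).2 (h W U hW hU)), fun h W U hW hU ↦ ?_⟩
  · rintro (h | h) W U hW hU
    · exact (h1 hW hU).1 (h W U hW hU)
    · exact (h2 hW hU).1 (h W U hW hU)
  · exact (h W U hW hU).elim (h1 hW hU).1 (h2 hW hU).1
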